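/- Let $p$ be a prime and $P$ a finite $p$-group. Write maps on the right and $x^g = g^{-1}xg$. A fusion system $\mathcal F$ on $P$ consists of a set $\operatorname{Hom}_{\mathcal F}(Q,R)$ of injective homomorphisms $Q\to R$ for all $Q,R\le P$, closed under composition, such that: for each $g\in P$ with $Q^g\le R$ the conjugation map $x\mapsto x^g$ lies in $\operatorname{Hom}_{\mathcal F}(Q,R)$; for each $\phi\in\operatorname{Hom}_{\mathcal F}(Q,R)$ the induced isomorphism $Q\to Q\phi$ lies in $\operatorname{Hom}_{\mathcal F}(Q,Q\phi)$; and inverses of isomorphisms in $\mathcal F$ lie in $\mathcal F$. A subgroup $Q$ is fully normalized if $|N_P(Q)|\ge|N_P(R)|$ whenever there is an isomorphism $Q\to R$ in $\mathcal F$. The fusion system $\mathcal F$ is saturated if $\operatorname{Aut}_P(P)$, the group of inner automorphisms of $P$, is a Sylow $p$-subgroup of $\operatorname{Aut}_{\mathcal F}(P)=\operatorname{Hom}_{\mathcal F}(P,P)$, and every morphism $\phi:Q\to P$ in $\mathcal F$ with $Q\phi$ fully normalized extends to a morphism $N_\phi\to P$ in $\mathcal F$, where $N_\phi$ is the group of all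 $x\in N_P(Q)$ for which there is $y\in N_P(Q\phi)$ with $(g^x)\phi=(g\phi)^y$ for all $g\in Q$. For $Q\le P$, the normalizer $N_{\mathcal F}(Q)$ is the system on $N_P(Q)$ whose morphisms $R\to S$ (for $R,S\le N_P(Q)$) are those $\phi\in\operatorname{Hom}_{\mathcal F}(R,S)$ that extend to some $\bar\phi\in\operatorname{Hom}_{\mathcal F}(QR,QS)$ with $\bar\phi|_Q$ an automorphism of $Q$. By $\mathcal F_Q(Q)$ we denote the fusion system on $Q$ whose morphisms are the maps between subgroups of $Q$ induced by conjugation by elements of $Q$. A subsystem $\mathcal E$ of $\mathcal F$ on a subgroup $Q$ (a fusion system on $Q$ all of whose morphisms lie in $\mathcal F$) is normal in $\mathcal F$ if it is saturated, $Q$ is strongly $\mathcal F$-closed (every $\mathcal F$-morphism whose domain is contained in $Q$ has its image contained in $Q$), and for all $R\le S\le Q$, $\phi\in\operatorname{Hom}_{\mathcal E}(R,S)$ and $\psi\in\operatorname{Hom}_{\mathcal F}(S,P)$, the map $\psi^{-1}\phi\psi$ lies in $\operatorname{Hom}_{\mathcal E}(R\psi,Q)$. Theorem. Let $\mathcal F$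 be a saturated fusion system on the finite $p$-group $P$, and let $Q\le P$. Then $\mathcal F=N_{\mathcal F}(Q)$ if and only if $\mathcal F_Q(Q)$ is a normal subsystem of $\mathcal F$. -/

import Mathlib

/-!
Fusion systems on subgroups of a group `G`. Following the usual convention in this area, elements
act by conjugation from the right, `x ^ g = g⁻¹ * x * g`. The objects of a system on `P ≤ G` are
the subgroups of `P`.
-/

/-- A prefusion system on a subgroup `carrier` of `G`: for any two subgroups `Q, R` of `carrier`, a
set of injective homomorphisms `Q → R`. (There are no morphisms between other subgroups of `G`.) -/
@[ext]
structure PrefusionSystem (G : Type*) [Group G] where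
  /-- The group `P` on which the system lives. -/
  carrier : Subgroup G
  /-- The set of morphisms from `Q` to `R`. -/
  Hom : ∀ Q R : Subgroup G, Set (Q →* R)
  source_le : ∀ {Q R : Subgroup G} {φ : Q →* R}, φ ∈ Hom Q R → Q ≤ carrier
  target_le : ∀ {Q R : Subgroup G} {φ : Q →* R}, φ ∈ Hom Q R → R ≤ carrier
  injective : ∀ {Q R : Subgroup G} {φ : Q →* R}, φ ∈ Hom Q R → Function.Injective φ

namespace PrefusionSystem

variable {G : Type*} [Group G]

/-- The image `Qφ` of `φ : Q → R`, as a subgroup of `G`. -/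
def image {Q R : Subgroup G} (φ : Q →* R) : Subgroup G :=
  (R.subtype.comp φ).range

/-- The homomorphism `φ : Q → R`, regarded as a surjective homomorphism `Q → Qφ`. -/
def toImage {Q R : Subgroup G} (φ : Q →* R) : Q →* image φ :=
  (R.subtype.comp φ).rangeRestrict

/-- `ψ : Q' → R'` extends `φ : Q → R`: `Q ≤ Q'`, and `ψ` agrees with `φ` on `Q`. -/
def Extends {Q' R' Q R : Subgroup G} (ψ : Q' →* R') (φ : Q →* R) : Prop :=
  ∃ h : Q ≤ Q', ∀ x : Q, (ψ (Subgroup.inclusion h x) : G) = φ x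

/-- The axioms of a fusion system. -/
structure IsFusionSystem (F : PrefusionSystem G) : Prop where
  comp_mem : ∀ {Q R S : Subgroup G} {φ : Q →* R} {ψ : R →* S},
    φ ∈ F.Hom Q R → ψ ∈ F.Hom R S → ψ.comp φ ∈ F.Hom Q S
  /-- Conjugation by any `g ∈ P` with `Q ^ g ≤ R` is a morphism `Q → R`. -/
  conj_mem : ∀ {Q R : Subgroup G}, Q ≤ F.carrier → R ≤ F.carrier →
    ∀ g ∈ F.carrier, ∀ φ : Q →* R, (∀ x : Q, (φ x : G) = g⁻¹ * x * g) → φ ∈ F.Hom Q R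
  toImage_mem : ∀ {Q R : Subgroup G} {φ : Q →* R},
    φ ∈ F.Hom Q R → toImage φ ∈ F.Hom Q (image φ)
  symm_mem : ∀ {Q R : Subgroup G} (e : Q ≃* R),
    e.toMonoidHom ∈ F.Hom Q R → e.symm.toMonoidHom ∈ F.Hom R Q

/-- The group `Aut_F(Q)` of all `F`-automorphisms of `Q ≤ P`. -/
def IsFusionSystem.aut {F : PrefusionSystem G} (hF : F.IsFusionSystem) (Q : Subgroup G)
    (hQ : Q ≤ F.carrier) : Subgroup (MulAut Q) where
  carrier := {α | α.toMonoidHom ∈ F.Hom Q Q}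
  one_mem' := hF.conj_mem hQ hQ 1 (one_mem _) _ fun x => by simp
  mul_mem' := fun {_ _} ha hb => hF.comp_mem hb ha
  inv_mem' := fun {α} ha => hF.symm_mem α ha

/-- The group `Aut_P(Q)` of all automorphisms of `Q` induced by conjugation by elements
of `N_P(Q)`. -/
def conjAut (P Q : Subgroup G) : Subgroup (MulAut Q) :=
  (P.subgroupOf (Subgroup.normalizer (Q : Set G))).map Q.normalizerMonoidHom

/-- The normalizer `N_P(Q)`. -/
def norm (P Q : Subgroup G) : Subgroup G :=
  P ⊓ Subgroup.normalizer (Q : Set G)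

/-- `Q` is fully normalized: `|N_P(Q)| ≥ |N_P(R)|` for every `R` that is `F`-isomorphic to `Q`. -/
def FullyNormalized (F : PrefusionSystem G) (Q : Subgroup G) : Prop :=
  Q ≤ F.carrier ∧ ∀ (R : Subgroup G) (e : Q ≃* R), e.toMonoidHom ∈ F.Hom Q R →
    Nat.card (norm F.carrier R) ≤ Nat.card (norm F.carrier Q)

/-- The group `N_φ` for `φ : Q → R`: all `x ∈ N_P(Q)` such that, for some `y ∈ N_P(Qφ)`,
`(g ^ x)φ = (gφ) ^ y` for all `g ∈ Q`. -/
def extensionGroup (P : Subgroup G) {Q R : Subgroup G} (φ : Q →* R) : Subgroup G where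
  carrier := {x | x ∈ norm P Q ∧ ∃ y ∈ norm P (image φ),
    ∀ g h : Q, (h : G) = x⁻¹ * g * x → (φ h : G) = y⁻¹ * φ g * y}
  one_mem' := ⟨one_mem _, 1, one_mem _, fun g h hh => by
    have : h = g := Subtype.ext (by simpa using hh)
    simp [this]⟩
  mul_mem' := by
    rintro a b ⟨ha, y, hy, hay⟩ ⟨hb, z, hz, hbz⟩
    refine ⟨mul_mem ha hb, y * z, mul_mem hy hz, fun g h hh => ?_⟩
    have hk : a⁻¹ * (g : G) * a ∈ Q := (Subgroup.mem_normalizer_iff''.1 ha.2 g).1 g.2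
    have h1 := hay g ⟨_, hk⟩ rfl
    have h2 := hbz ⟨_, hk⟩ h (by rw [hh]; group)
    rw [h2, h1]; group
  inv_mem' := by
    rintro a ⟨ha, y, hy, hay⟩
    refine ⟨inv_mem ha, y⁻¹, inv_mem hy, fun g h hh => ?_⟩
    have h1 := hay h g (by rw [hh]; group)
    rw [h1]; group

/-- A saturated fusion system (for the prime `p`) on `P`. -/
structure IsSaturated (p : ℕ) (F : PrefusionSystem G) : Prop extends F.IsFusionSystem where
  /-- `Aut_P(P)` is a Sylow `p`-subgroup of `Aut_F(P)`. -/
  sylow : ∃ S : Sylow p (toIsFusionSystem.aut F.carrier le_rfl),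
    (S : Subgroup (toIsFusionSystem.aut F.carrier le_rfl)).map (Subgroup.subtype _) =
      conjAut F.carrier F.carrier
  /-- Every morphism `φ : Q → P` such that `Qφ` is fully normalized extends to a morphism
  `N_φ → P`. -/
  extension : ∀ (Q : Subgroup G), ∀ φ ∈ F.Hom Q F.carrier, F.FullyNormalized (image φ) →
    ∃ ψ ∈ F.Hom (extensionGroup F.carrier φ) F.carrier, Extends ψ φ

/-- `Q` is strongly `F`-closed: a morphism whose domain is a subgroup of `Q` has its image
in `Q`. -/
def StronglyClosed (F : PrefusionSystem G) (Q : Subgroup G) : Prop :=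
  Q ≤ F.carrier ∧ ∀ (R S : Subgroup G), R ≤ Q → ∀ φ ∈ F.Hom R S, image φ ≤ Q

/-- `E` is a subsystem of `F`. -/
def IsSubsystem (E F : PrefusionSystem G) : Prop :=
  E.IsFusionSystem ∧ E.carrier ≤ F.carrier ∧ ∀ Q R : Subgroup G, E.Hom Q R ⊆ F.Hom Q R

/-- The subsystem `E`, on `Q`, is `F`-invariant: `Q` is strongly `F`-closed and, for all
`R ≤ S ≤ Q`, `φ ∈ Hom_E(R, S)` and `ψ ∈ Hom_F(S, P)`, the map `ψ⁻¹φψ` (maps written on the right;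
it sends `rψ` to `rφψ`) lies in `Hom_E(Rψ, Q)`. -/
structure IsInvariant (E F : PrefusionSystem G) : Prop where
  isSubsystem : IsSubsystem E F
  stronglyClosed : F.StronglyClosed E.carrier
  conj_mem : ∀ (R S : Subgroup G) (hRS : R ≤ S), S ≤ E.carrier →
    ∀ φ ∈ E.Hom R S, ∀ ψ ∈ F.Hom S F.carrier,
      ∃ χ ∈ E.Hom (image (ψ.comp (Subgroup.inclusion hRS))) E.carrier,
        ∀ r : R, (χ (toImage (ψ.comp (Subgroup.inclusion hRS)) r) : G) = ψ (φ r)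

/-- `E` is a normal subsystem of `F`: it is `F`-invariant and saturated. -/
def IsNormalSubsystem (p : ℕ) (E F : PrefusionSystem G) : Prop :=
  IsInvariant E F ∧ E.IsSaturated p

/-- The fusion system `F_Q(Q)` on `Q`, whose morphisms are induced by conjugation by elements
of `Q`. -/
def inner (Q : Subgroup G) : PrefusionSystem G where
  carrier := Q
  Hom R S := {φ | R ≤ Q ∧ S ≤ Q ∧ ∃ g ∈ Q, ∀ x : R, (φ x : G) = g⁻¹ * x * g}
  source_le h := h.1
  target_le h := h.2.1
  injective := by
    rintro R S φ ⟨-, -, g, -, hg⟩ x y hxy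
    have h := congrArg (Subtype.val) hxy
    rw [hg, hg] at h
    exact Subtype.ext (by simpa using h)

/-- The normalizer `N_F(Q)` of `Q ≤ P` in `F`, a system on `N_P(Q)`: its morphisms `R → S` are
the morphisms of `F` that extend to a morphism `QR → QS` of `F` which induces an automorphism
of `Q`. (Here `QR` is the join of `Q` and `R`, because `R` normalizes `Q`.) -/
def normalizer (F : PrefusionSystem G) (Q : Subgroup G) : PrefusionSystem G where
  carrier := norm F.carrier Q
  Hom R S := {φ | R ≤ norm F.carrier Q ∧ S ≤ norm F.carrier Q ∧ φ ∈ F.Hom R S ∧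
    ∃ ψ ∈ F.Hom (Q ⊔ R) (Q ⊔ S), Extends ψ φ ∧ ∃ α : MulAut Q, Extends ψ α.toMonoidHom}
  source_le h := h.1
  target_le h := h.2.1
  injective h := F.injective h.2.2.1

end PrefusionSystem

/-! If `F = N_F(Q)`, every morphism on a subgroup of `Q` is the restriction of an automorphism `α`
of `Q`. Hence `Q` is strongly closed, and transport along the morphism turns conjugation by `g` into
conjugation by `gα`, so `F_Q(Q)` is invariant. Its saturation is elementary.

Conversely, let `F_Q(Q)` be invariant. It suffices to extend every `F`-isomorphism `f : R → T` to
`RQ → TQ` (`IsInvariant.exists_extension_sup`), since strong closure then forces `Q` to be mapped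
onto itself. By composing with an isomorphism onto a fully normalized subgroup, `T` may be taken
fully normalized. If `Q` is not contained in `R`, then `R` is properly contained in its normalizer
in `RQ`; once `f` extends to that normalizer, downward induction on `|R|` finishes the argument.

For this extension it must be shown that `f` carries conjugation by `q ∈ N_Q(R)` to conjugation by
an element of `N_P(T)`. The automorphisms of `T` that can arise lie in the group `cosetAut`, which
is preserved by `F`-isomorphisms. It is a `p`-group normalized by `Aut_P(T)`, and `Aut_P(T)` is a
maximal `p`-subgroup of `Aut_F(T)` (`IsSaturated.fullyAutomized`), so `Aut_P(T)` contains it. -/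

namespace PrefusionSystem

variable {G : Type*} [Group G] {F : PrefusionSystem G} {p : ℕ} {Q : Subgroup G}

/-! ### Calculus of `F`-isomorphisms, represented by functions on the ambient group -/

/-- The function `f` restricts to an `F`-isomorphism from `R` onto `T`. -/
def IsoOn (F : PrefusionSystem G) (R : Subgroup G) (f : G → G) (T : Subgroup G) : Prop :=
  ∃ e : R ≃* T, e.toMonoidHom ∈ F.Hom R T ∧ ∀ x : R, (e x : G) = f x

open Classical in
/-- A homomorphism between subgroups, extended by the identity to the whole group. -/
noncomputable def extendFun {R S : Subgroup G} (φ : R →* S) (x : G) : G :=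
  if h : x ∈ R then φ ⟨x, h⟩ else x

theorem extendFun_apply {R S : Subgroup G} (φ : R →* S) (x : R) : extendFun φ x = φ x := by
  simp [extendFun]

theorem IsFusionSystem.inclusion_mem (hF : F.IsFusionSystem) {R S : Subgroup G} (h : R ≤ S)
    (hS : S ≤ F.carrier) : Subgroup.inclusion h ∈ F.Hom R S :=
  hF.conj_mem (h.trans hS) hS 1 (one_mem _) _ fun x => by simp

theorem IsFusionSystem.isoOn_of_hom (hF : F.IsFusionSystem) {R S : Subgroup G} {φ : R →* S}
    (hφ : φ ∈ F.Hom R S) {f : G → G} (h : ∀ x : R, (φ x : G) = f x) :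
    F.IsoOn R f (image φ) := by
  refine ⟨MulEquiv.ofBijective (toImage φ) ⟨F.injective (hF.toImage_mem hφ), ?_⟩,
    hF.toImage_mem hφ, h⟩
  exact MonoidHom.rangeRestrict_surjective _

namespace IsoOn

variable {R S T U : Subgroup G} {f g : G → G}

theorem mem (h : F.IsoOn R f T) {x : G} (hx : x ∈ R) : f x ∈ T := by
  obtain ⟨e, -, he⟩ := h
  rw [← he ⟨x, hx⟩]; exact SetLike.coe_mem _

theorem exists_eq (h : F.IsoOn R f T) {y : G} (hy : y ∈ T) : ∃ x ∈ R, f x = y := by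
  obtain ⟨e, -, he⟩ := h
  exact ⟨e.symm ⟨y, hy⟩, SetLike.coe_mem _, by rw [← he]; simp⟩

theorem inj (h : F.IsoOn R f T) {x y : G} (hx : x ∈ R) (hy : y ∈ R) (hxy : f x = f y) :
    x = y := by
  obtain ⟨e, -, he⟩ := h
  rw [← he ⟨x, hx⟩, ← he ⟨y, hy⟩] at hxy
  simpa using hxy

theorem map_mul (h : F.IsoOn R f T) {x y : G} (hx : x ∈ R) (hy : y ∈ R) :
    f (x * y) = f x * f y := by
  obtain ⟨e, -, he⟩ := h
  rw [← he ⟨x, hx⟩, ← he ⟨y, hy⟩, ← he ⟨x * y, mul_mem hx hy⟩, ← Subgroup.coe_mul, ← _root_.map_mul]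
  rfl

theorem map_inv (h : F.IsoOn R f T) {x : G} (hx : x ∈ R) : f x⁻¹ = (f x)⁻¹ := by
  obtain ⟨e, -, he⟩ := h
  rw [← he ⟨x, hx⟩, ← he ⟨x⁻¹, inv_mem hx⟩, ← Subgroup.coe_inv, ← _root_.map_inv]
  rfl

theorem map_conj (h : F.IsoOn R f T) {x y : G} (hx : x ∈ R) (hy : y ∈ R) :
    f (x⁻¹ * y * x) = (f x)⁻¹ * f y * f x := by
  rw [h.map_mul (mul_mem (inv_mem hx) hy) hx, h.map_mul (inv_mem hx) hy, h.map_inv hx]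

theorem card_eq (h : F.IsoOn R f T) : Nat.card R = Nat.card T :=
  let ⟨e, _⟩ := h; Nat.card_congr e.toEquiv

theorem congr (h : F.IsoOn R f T) (hfg : ∀ x ∈ R, f x = g x) : F.IsoOn R g T := by
  obtain ⟨e, he, hef⟩ := h
  exact ⟨e, he, fun x => (hef x).trans (hfg x x.2)⟩

theorem hom_mem (hF : F.IsFusionSystem) (h : F.IsoOn R f T) (hS : S ≤ F.carrier) (φ : R →* S)
    (hφ : ∀ x : R, (φ x : G) = f x) : φ ∈ F.Hom R S := by
  have hTS : T ≤ S := fun y hy => by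
    obtain ⟨x, hx, rfl⟩ := h.exists_eq hy
    rw [← hφ ⟨x, hx⟩]; exact SetLike.coe_mem _
  obtain ⟨e, he, hef⟩ := h
  have : φ = (Subgroup.inclusion hTS).comp e.toMonoidHom := by
    ext x; simp [hφ, hef]
  rw [this]
  exact hF.comp_mem he (hF.inclusion_mem hTS hS)

theorem symm (hF : F.IsFusionSystem) (h : F.IsoOn R f T) :
    ∃ g, F.IsoOn T g R ∧ (∀ x ∈ R, g (f x) = x) ∧ ∀ y ∈ T, f (g y) = y := by
  obtain ⟨e, he, hef⟩ := h
  refine ⟨extendFun e.symm.toMonoidHom, ⟨e.symm, hF.symm_mem e he, fun x => ?_⟩,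
    fun x hx => ?_, fun y hy => ?_⟩
  · rw [extendFun_apply]; rfl
  · rw [← hef ⟨x, hx⟩, extendFun_apply]; simp
  · rw [show y = ((⟨y, hy⟩ : T) : G) from rfl, extendFun_apply, ← hef]; simp

theorem trans (hF : F.IsFusionSystem) (h : F.IsoOn R f T) (h' : F.IsoOn T g U) :
    F.IsoOn R (fun x => g (f x)) U := by
  obtain ⟨e, he, hef⟩ := h
  obtain ⟨e', he', hef'⟩ := h'
  exact ⟨e.trans e', hF.comp_mem he he', fun x => by simp [← hef, ← hef']⟩

theorem source_le (h : F.IsoOn R f T) : R ≤ F.carrier :=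
  let ⟨_, he, _⟩ := h; F.source_le he

theorem target_le (h : F.IsoOn R f T) : T ≤ F.carrier :=
  let ⟨_, he, _⟩ := h; F.target_le he

theorem restrict (hF : F.IsFusionSystem) (h : F.IsoOn R f T) (hSR : S ≤ R) :
    ∃ U ≤ T, F.IsoOn S f U := by
  have hR := h.source_le
  obtain ⟨e, he, hef⟩ := h
  refine ⟨image (e.toMonoidHom.comp (Subgroup.inclusion hSR)), ?_,
    hF.isoOn_of_hom (hF.comp_mem (hF.inclusion_mem hSR hR) he) fun x => ?_⟩
  · rintro _ ⟨x, rfl⟩; exact SetLike.coe_mem _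
  · simp [hef]

theorem refl (hF : F.IsFusionSystem) (hR : R ≤ F.carrier) : F.IsoOn R id R :=
  ⟨MulEquiv.refl R, hF.inclusion_mem le_rfl hR, fun _ => rfl⟩

/-- An `F`-isomorphism maps the elements normalizing a subgroup to elements normalizing its
image. -/
theorem map_mem_normalizer (h : F.IsoOn R f T) (hS : F.IsoOn S f U) (hSR : S ≤ R) {x : G}
    (hx : x ∈ R) (hxS : x ∈ Subgroup.normalizer (S : Set G)) :
    f x ∈ Subgroup.normalizer (U : Set G) := by
  have key : ∀ z ∈ R, z ∈ Subgroup.normalizer (S : Set G) → ∀ y ∈ U,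
      (f z)⁻¹ * y * f z ∈ U := by
    intro z hz hzS y hy
    obtain ⟨s, hs, rfl⟩ := hS.exists_eq hy
    rw [← h.map_conj hz (hSR hs)]
    exact hS.mem ((Subgroup.mem_normalizer_iff''.1 hzS s).1 hs)
  refine Subgroup.mem_normalizer_iff''.2 fun y => ⟨key x hx hxS y, fun hy => ?_⟩
  have := key x⁻¹ (inv_mem hx) (inv_mem hxS) _ hy
  rw [h.map_inv hx] at this
  simpa [mul_assoc] using this

end IsoOn

/-! ### Fully normalized subgroups and the extension axiom -/

theorem mem_conjAut_top {T : Subgroup G} {α : MulAut T} :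
    α ∈ conjAut ⊤ T ↔
      ∃ y ∈ Subgroup.normalizer (T : Set G), ∀ x : T, (α x : G) = y * x * y⁻¹ := by
  constructor
  · rintro ⟨y, -, rfl⟩
    exact ⟨y, y.2, fun x => rfl⟩
  · rintro ⟨y, hy, h⟩
    refine ⟨⟨y, hy⟩, by simp, ?_⟩
    ext x
    exact (h x).symm

theorem norm_top (T : Subgroup G) : norm ⊤ T = Subgroup.normalizer (T : Set G) := top_inf_eq _

theorem FullyNormalized.card_le {T R : Subgroup G} {f : G → G} (hc : F.carrier = ⊤)
    (hT : F.FullyNormalized T) (h : F.IsoOn T f R) :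
    Nat.card (Subgroup.normalizer (R : Set G)) ≤ Nat.card (Subgroup.normalizer (T : Set G)) := by
  obtain ⟨e, he, -⟩ := h
  have := hT.2 R e he
  rwa [hc, norm_top, norm_top] at this

/-- Every subgroup of `P` is `F`-isomorphic to a fully normalized one. -/
theorem IsFusionSystem.exists_fullyNormalized [Finite G] (hF : F.IsFusionSystem)
    {R : Subgroup G} (hR : R ≤ F.carrier) : ∃ f T, F.IsoOn R f T ∧ F.FullyNormalized T := by
  obtain ⟨T, ⟨f, hf⟩, hmax⟩ := Set.exists_max_image {T | ∃ f, F.IsoOn R f T}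
    (fun T => Nat.card (norm F.carrier T)) (Set.toFinite _) ⟨R, id, IsoOn.refl hF hR⟩
  exact ⟨f, T, hf, hf.target_le, fun S e he => hmax S ⟨_, hf.trans hF (T := T)
    (g := extendFun e.toMonoidHom) ⟨e, he, fun x => (extendFun_apply e.toMonoidHom x).symm⟩⟩⟩

/-- The extension axiom for subgroups `N` of `N_f`. -/
theorem IsSaturated.exists_extension {p : ℕ} (hc : F.carrier = ⊤) (hF : F.IsSaturated p)
    {R T N : Subgroup G} {f : G → G} (h : F.IsoOn R f T) (hT : F.FullyNormalized T)
    (hN : ∀ x ∈ N, x ∈ Subgroup.normalizer (R : Set G) ∧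
      ∃ y ∈ Subgroup.normalizer (T : Set G), ∀ g ∈ R, f (x⁻¹ * g * x) = y⁻¹ * f g * y) :
    ∃ f' U, F.IsoOn N f' U ∧ ∀ x ∈ R ⊓ N, f' x = f x := by
  have hTc := h.target_le
  obtain ⟨e, he, hef⟩ := id h
  set φ : R →* F.carrier := (Subgroup.inclusion hTc).comp e.toMonoidHom with hφ
  have hφf : ∀ x : R, (φ x : G) = f x := hef
  have him : image φ = T := by
    ext y
    exact ⟨fun ⟨x, hx⟩ => hx ▸ SetLike.coe_mem (e x), fun hy =>
      ⟨e.symm ⟨y, hy⟩, by simp [hφ]⟩⟩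
  obtain ⟨ψ, hψ, hle, hext⟩ := hF.extension R φ
    (hF.comp_mem he (hF.inclusion_mem hTc le_rfl)) (him.symm ▸ hT)
  have hNle : N ≤ extensionGroup F.carrier φ := by
    intro x hx
    obtain ⟨hxR, y, hy, hxy⟩ := hN x hx
    refine ⟨by rwa [hc, norm_top], y, by rwa [him, hc, norm_top], fun g k hk => ?_⟩
    rw [hφf, hφf, hk, hxy g g.2]
  have hiso := hF.isoOn_of_hom hψ (f := extendFun ψ) fun x => (extendFun_apply _ x).symm
  obtain ⟨U, -, hU⟩ := hiso.restrict hF.toIsFusionSystem hNle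
  refine ⟨_, U, hU, fun x hx => ?_⟩
  have h1 := hext ⟨x, hx.1⟩
  rw [hφf] at h1
  rw [← h1, ← extendFun_apply]; rfl

/-! ### Maximality of `Aut_P(T)` among the `p`-subgroups of `Aut_F(T)` -/

theorem isoOn_extendFun {T : Subgroup G} {α : MulAut T} (hα : α.toMonoidHom ∈ F.Hom T T) :
    F.IsoOn T (extendFun α.toMonoidHom) T :=
  ⟨α, hα, fun x => (extendFun_apply α.toMonoidHom x).symm⟩

/-- `Aut_P(T)` is a maximal `p`-subgroup of `Aut_F(T)`. -/
def FullyAutomized (p : ℕ) (F : PrefusionSystem G) (T : Subgroup G) : Prop :=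
  ∀ B : Subgroup (MulAut T), IsPGroup p B → (∀ α ∈ B, α.toMonoidHom ∈ F.Hom T T) →
    conjAut F.carrier T ≤ B → B ≤ conjAut F.carrier T

theorem IsSaturated.fullyAutomized_carrier (hF : F.IsSaturated p) :
    FullyAutomized p F F.carrier := by
  intro B hB hBF hle
  obtain ⟨S, hS⟩ := hF.sylow
  let A := hF.toIsFusionSystem.aut F.carrier le_rfl
  have hBA : B ≤ A := hBF
  have h1 : S.toSubgroup ≤ B.subgroupOf A := by
    intro s hs
    exact hle (hS ▸ Subgroup.mem_map_of_mem A.subtype hs)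
  have h2 : B.subgroupOf A = S :=
    S.is_maximal' (hB.of_injective (Subgroup.subgroupOfEquivOfLe hBA).toMonoidHom
      (Subgroup.subgroupOfEquivOfLe hBA).injective) h1
  rw [← hS]
  change B ≤ S.toSubgroup.map A.subtype
  rw [← h2, Subgroup.subgroupOf_map_subtype]
  exact le_inf le_rfl hBA

theorem conjAut_isPGroup (hP : IsPGroup p G) (P T : Subgroup G) : IsPGroup p (conjAut P T) :=
  ((hP.to_subgroup _).to_subgroup _).map _

theorem IsFusionSystem.conjAut_le_aut (hF : F.IsFusionSystem) {T : Subgroup G}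
    (hT : T ≤ F.carrier) : conjAut F.carrier T ≤ hF.aut T hT := by
  rintro _ ⟨y, hy, rfl⟩
  exact hF.conj_mem hT hT (y⁻¹ : G) (inv_mem hy) _ fun x => by
    rw [inv_inv]; rfl

/-- Sylow's theorem in `Aut_F(T)`. -/
theorem FullyAutomized.exists_conj_mem [Finite G] [Fact p.Prime] (hP : IsPGroup p G)
    (hF : F.IsFusionSystem) {T : Subgroup G} (hT : T ≤ F.carrier) (h : FullyAutomized p F T)
    {α : MulAut T} (hα : α.toMonoidHom ∈ F.Hom T T) (hp : ∃ k, orderOf α = p ^ k) :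
    ∃ β : MulAut T, β.toMonoidHom ∈ F.Hom T T ∧ β * α * β⁻¹ ∈ conjAut F.carrier T := by
  have hle := hF.conjAut_le_aut hT
  set A := hF.aut T hT
  set C := conjAut F.carrier T
  let S : Sylow p A :=
    { toSubgroup := C.subgroupOf A
      isPGroup' := (conjAut_isPGroup hP _ _).of_injective
        (Subgroup.subgroupOfEquivOfLe hle).toMonoidHom
        (Subgroup.subgroupOfEquivOfLe hle).injective
      is_maximal' := by
        intro B hB hCB
        refine le_antisymm (fun b hb => ?_) hCB
        refine h (B.map A.subtype) (hB.map _) ?_ ?_ ⟨b, hb, rfl⟩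
        · rintro _ ⟨c, -, rfl⟩
          exact c.2
        · intro c hc
          exact ⟨⟨c, hle hc⟩, hCB hc, rfl⟩ }
  let a : A := ⟨α, hα⟩
  have ha : IsPGroup p (Subgroup.zpowers a) := by
    obtain ⟨k, hk⟩ := hp
    refine IsPGroup.of_card (n := k) ?_
    rw [Nat.card_zpowers, ← hk]
    exact (Subgroup.orderOf_coe a).symm
  obtain ⟨S', hS'⟩ := ha.exists_le_sylow
  obtain ⟨b, hb⟩ := MulAction.exists_smul_eq A S' S
  refine ⟨b, b.2, ?_⟩
  have : b * a * b⁻¹ ∈ S := by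
    rw [← hb]
    exact Subgroup.smul_mem_pointwise_smul a (MulAut.conj b) _ (hS' (Subgroup.mem_zpowers a))
  exact this

theorem lt_normalizer_of_ne_top [Finite G] [Fact p.Prime] (hP : IsPGroup p G) {H : Subgroup G}
    (hH : H ≠ ⊤) : H < Subgroup.normalizer (H : Set G) :=
  haveI := hP.isNilpotent
  Group.normalizerCondition_of_isNilpotent H (lt_top_iff_ne_top.2 hH)

/-- Some power of an element, with exponent prime to `p`, has `p`-power order. -/
theorem exists_pow_orderOf_eq {A : Type*} [Group A] [Finite A] [hp : Fact p.Prime] (a : A) :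
    ∃ m, m.Coprime p ∧ ∃ k, orderOf (a ^ m) = p ^ k := by
  obtain ⟨k, m, hm, h⟩ := Nat.exists_eq_pow_mul_and_not_dvd (orderOf_pos a).ne' p hp.out.ne_one
  refine ⟨m, ((Nat.Prime.coprime_iff_not_dvd hp.out).2 hm).symm, k, ?_⟩
  have hm0 : m ≠ 0 := by rintro rfl; exact hm (dvd_zero _)
  rw [orderOf_pow_of_dvd hm0 (h ▸ dvd_mul_left m _), h,
    Nat.mul_div_cancel _ (Nat.pos_of_ne_zero hm0)]

theorem mem_of_pow_mem_of_coprime {A : Type*} [Group A] {H : Subgroup A} {a : A} {k m : ℕ}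
    (ha : a ^ (p ^ k) = 1) (hm : m.Coprime p) (h : a ^ m ∈ H) : a ∈ H := by
  have : m.Coprime (orderOf a) :=
    (hm.pow_right k).coprime_dvd_right (orderOf_dvd_of_pow_eq_one ha)
  obtain ⟨n, hn⟩ := exists_pow_eq_self_of_coprime this
  rw [← hn]
  exact pow_mem h n

theorem le_norm_self (T : Subgroup G) : T ≤ Subgroup.normalizer (T : Set G) :=
  Subgroup.le_normalizer

/-- An `F`-automorphism of `T` normalizing `Aut_P(T)` extends to an `F`-automorphism
of `N_P(T)` if `T` is fully normalized. -/
theorem IsSaturated.exists_extension_normalizer [Finite G] (hc : F.carrier = ⊤)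
    (hF : F.IsSaturated p) {T : Subgroup G} (hT : F.FullyNormalized T) {φ : MulAut T}
    (hφF : φ.toMonoidHom ∈ F.Hom T T)
    (hφ : ∀ c ∈ conjAut F.carrier T, φ * c * φ⁻¹ ∈ conjAut F.carrier T) :
    ∃ ψ : MulAut (Subgroup.normalizer (T : Set G)),
      ψ.toMonoidHom ∈ F.Hom (Subgroup.normalizer (T : Set G)) (Subgroup.normalizer (T : Set G)) ∧
      ∀ x : T, (ψ ⟨x, le_norm_self T x.2⟩ : G) = φ x := by
  rw [hc] at hφ
  have hf := isoOn_extendFun hφF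
  set f := extendFun φ.toMonoidHom with hfdef
  have hfφ : ∀ x : T, f x = φ x := fun x => extendFun_apply φ.toMonoidHom x
  set N := Subgroup.normalizer (T : Set G)
  obtain ⟨f', U, hf', heq⟩ := hF.exists_extension hc (N := N) hf hT fun x hx => by
    refine ⟨hx, ?_⟩
    -- `normalizerMonoidHom` conjugates from the left and `N_φ` from the right, hence the inverse of
    -- `x` here and the witness `z⁻¹` below.
    obtain ⟨z, hz, hzφ⟩ := mem_conjAut_top.1 (hφ (T.normalizerMonoidHom ⟨x⁻¹, inv_mem hx⟩)
      (mem_conjAut_top.2 ⟨x⁻¹, inv_mem hx, fun g => rfl⟩))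
    refine ⟨z⁻¹, inv_mem hz, fun g hg => ?_⟩
    have := hzφ (φ ⟨g, hg⟩)
    simp only [MulAut.mul_apply, MulAut.inv_apply_self] at this
    rw [← hfφ, ← hfφ] at this
    rw [inv_inv, ← this]
    exact congrArg f (by simp)
  have hfT : F.IsoOn T f' T := hf.congr fun x hx => (heq x ⟨hx, le_norm_self T hx⟩).symm
  have hUN : U ≤ N := fun y hy => by
    obtain ⟨x, hx, rfl⟩ := hf'.exists_eq hy
    exact hf'.map_mem_normalizer hfT (le_norm_self T) hx hx
  obtain rfl : U = N := Subgroup.eq_of_le_of_card_ge hUN hf'.card_eq.le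
  obtain ⟨ψ, hψ, hψf⟩ := hf'
  exact ⟨ψ, hψ, fun x => by rw [hψf, heq _ ⟨x.2, le_norm_self T x.2⟩, hfφ]⟩

/-- Saturation postulates the Sylow property only for `P`; it descends by induction from larger
subgroups. A `p`-automorphism `φ` normalizing `Aut_P(T)` extends to `N_P(T)`. Up to a power prime to
`p`, the extension is conjugate to an inner one on a fully normalized copy `M` of `N_P(T)`, and
pulling back the conjugating element shows that `φ` is already in `Aut_P(T)`. -/
theorem IsSaturated.fullyAutomized [Finite G] [Fact p.Prime] (hP : IsPGroup p G)
    (hc : F.carrier = ⊤) (hF : F.IsSaturated p) {T : Subgroup G} (hT : F.FullyNormalized T) :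
    FullyAutomized p F T := by
  induction hn : Nat.card G - Nat.card T using Nat.strong_induction_on generalizing T with
  | _ n ih =>
  by_cases hTop : T = F.carrier
  · subst hTop; exact hF.fullyAutomized_carrier
  intro B hB hBF hle
  by_contra hnot
  have hlt : (conjAut F.carrier T).subgroupOf B ≠ ⊤ := by
    rwa [Ne, Subgroup.subgroupOf_eq_top]
  obtain ⟨⟨φ, hφB⟩, hφn, hφC⟩ := SetLike.exists_of_lt (lt_normalizer_of_ne_top hB hlt)
  replace hφC : φ ∉ conjAut F.carrier T := hφC
  let N := Subgroup.normalizer (T : Set G)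
  obtain ⟨ψ, hψF, hψφ⟩ : ∃ ψ : MulAut N, ψ.toMonoidHom ∈ F.Hom N N ∧
      ∀ x : T, (ψ ⟨x, le_norm_self T x.2⟩ : G) = φ x :=
    hF.exists_extension_normalizer hc hT (hBF φ hφB) fun c hcC =>
    (Subgroup.mem_normalizer_iff.1 hφn ⟨c, hle hcC⟩).1 hcC
  have hTN : T ≤ N := le_norm_self T
  have hNc : N ≤ F.carrier := hc ▸ le_top
  -- The extension `ψ` need not have `p`-power order. As `φ` does, passing to a power prime to `p`
  -- keeps `φ ^ m` outside `Aut_P(T)`.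
  obtain ⟨m, hm, hψp⟩ := exists_pow_orderOf_eq (p := p) ψ
  have hφm : φ ^ m ∉ conjAut F.carrier T := fun h => by
    obtain ⟨k, hk⟩ := hB ⟨φ, hφB⟩
    exact hφC (mem_of_pow_mem_of_coprime (congrArg Subtype.val hk) hm h)
  have hψm : ∀ (m : ℕ) (x : T), ((ψ ^ m) ⟨x, hTN x.2⟩ : G) = (φ ^ m) x := by
    intro m
    induction m with
    | zero => intro x; rfl
    | succ k ihk =>
      intro x
      rw [pow_succ, pow_succ, MulAut.mul_apply, MulAut.mul_apply, ← ihk]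
      congr 3
      exact Subtype.ext (hψφ x)
  obtain ⟨τ, M, ⟨eτ, heτ, -⟩, hM⟩ := hF.exists_fullyNormalized hNc
  have hMN : Nat.card M = Nat.card N := (Nat.card_congr eτ.toEquiv).symm
  have hlt : T < N := lt_normalizer_of_ne_top hP (hc ▸ hTop)
  have hcard : Nat.card T < Nat.card N := by
    refine lt_of_le_of_ne (Subgroup.card_le_of_le hlt.le) fun h => hlt.ne ?_
    exact Subgroup.eq_of_le_of_card_ge hlt.le h.ge
  have hNG : Nat.card N ≤ Nat.card G := Subgroup.card_le_card_group N
  have hMA : FullyAutomized p F M := ih _ (by omega) hM rfl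
  have hψmF : (ψ ^ m).toMonoidHom ∈ F.Hom N N :=
    Subgroup.pow_mem (hF.toIsFusionSystem.aut N hNc) hψF m
  obtain ⟨β, hβF, hβ⟩ := hMA.exists_conj_mem hP hF.toIsFusionSystem hM.1
    (α := MulAut.congr eτ (ψ ^ m))
    (hF.comp_mem (hF.comp_mem (hF.symm_mem eτ heτ) hψmF) heτ)
    (by rwa [MulEquiv.orderOf_eq])
  rw [hc] at hβ
  obtain ⟨y, -, hy⟩ := mem_conjAut_top.1 hβ
  have hs : F.IsoOn N (extendFun (eτ.trans β).toMonoidHom) M :=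
    ⟨eτ.trans β, hF.comp_mem heτ hβF, fun x => (extendFun_apply (eτ.trans β).toMonoidHom x).symm⟩
  set s := extendFun (eτ.trans β).toMonoidHom
  have hsσ : ∀ x : N, s x = β (eτ x) := fun x => extendFun_apply (eτ.trans β).toMonoidHom x
  have hys : ∀ x : T, s ((φ ^ m) x) = y * s x * y⁻¹ := by
    intro x
    have := hy (β (eτ ⟨x, hTN x.2⟩))
    simp only [MulAut.mul_apply, MulAut.inv_apply_self] at this
    rw [← hsσ] at this
    rw [← this, ← hψm, hsσ]
    simp [MulAut.congr]
  obtain ⟨T', hT'M, hsT⟩ := hs.restrict hF.toIsFusionSystem hTN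
  have hMT' : M ≤ Subgroup.normalizer (T' : Set G) := fun z hz => by
    obtain ⟨x, hx, rfl⟩ := hs.exists_eq hz
    exact hs.map_mem_normalizer hsT hTN hx hx
  -- `T` is fully normalized, so `|N_P(T')| ≤ |N_P(T)| = |M|`.
  have hMeq : M = Subgroup.normalizer (T' : Set G) :=
    Subgroup.eq_of_le_of_card_ge hMT' (hMN ▸ hT.card_le hc hsT)
  -- Conjugation by `y` on `T'` corresponds under `s` to `φ ^ m` on `T`, so `y` normalizes `T'`.
  have hyM : y ∈ M := by
    rw [hMeq]
    refine Subgroup.mem_normalizer_fintype fun t ht => ?_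
    obtain ⟨x, hx, rfl⟩ := hsT.exists_eq ht
    rw [← hys ⟨x, hx⟩]
    exact hsT.mem (SetLike.coe_mem _)
  obtain ⟨z, hz, rfl⟩ := hs.exists_eq hyM
  apply hφm
  rw [hc]
  refine mem_conjAut_top.2 ⟨z, hz, fun x => ?_⟩
  have hzx : z * x * z⁻¹ ∈ T := (Subgroup.mem_normalizer_iff.1 hz x).1 x.2
  refine hsT.inj (SetLike.coe_mem _) hzx ?_
  rw [hys, hs.map_mul (mul_mem hz (hTN x.2)) (inv_mem hz), hs.map_mul hz (hTN x.2), hs.map_inv hz]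

/-! ### Strongly closed subgroups and invariance -/

theorem StronglyClosed.map_mem (hF : F.IsFusionSystem) (hQ : F.StronglyClosed Q)
    {R T : Subgroup G} {f : G → G} (h : F.IsoOn R f T) {x : G} (hx : x ∈ R) (hxQ : x ∈ Q) :
    f x ∈ Q := by
  obtain ⟨U, -, e, he, hef⟩ := h.restrict hF (inf_le_left : R ⊓ Q ≤ R)
  exact hQ.2 _ _ inf_le_right _ he ⟨⟨x, hx, hxQ⟩, hef _⟩

theorem StronglyClosed.normal (hc : F.carrier = ⊤) (hF : F.IsFusionSystem)
    (hQ : F.StronglyClosed Q) : Q.Normal := by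
  refine ⟨fun x hx g => ?_⟩
  have hT : (⊤ : Subgroup G) ≤ F.carrier := hc.ge
  have h := hF.isoOn_of_hom (f := fun x => g * x * g⁻¹)
    (hF.conj_mem hT hT g⁻¹ (hc ▸ Subgroup.mem_top _)
    ((Subgroup.inclusion le_top).comp
      ((MulAut.conj g).toMonoidHom.comp (⊤ : Subgroup G).subtype |>.codRestrict ⊤
        fun _ => Subgroup.mem_top _)) fun x => by simp) fun x => by simp
  exact hQ.map_mem hF h (Subgroup.mem_top x) hx

/-- This is the form in which invariance is used: conjugation by an element of `Q` stays of that
kind when transported along `f`. -/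
theorem IsInvariant.exists_conj (hF : F.IsFusionSystem) (hI : IsInvariant (inner Q) F)
    {S T : Subgroup G} {f : G → G} (h : F.IsoOn S f T) (hS : S ≤ Q) {g : G} (hg : g ∈ Q)
    (hgS : g ∈ Subgroup.normalizer (S : Set G)) :
    ∃ k ∈ Q, ∀ r ∈ S, f (g⁻¹ * r * g) = k⁻¹ * f r * k := by
  have hTc := h.target_le
  obtain ⟨e, he, hef⟩ := h
  let φ : S →* S := S.normalizerMonoidHom ⟨g⁻¹, inv_mem hgS⟩
  have hφ : ∀ x : S, (φ x : G) = g⁻¹ * x * g := fun x => by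
    change g⁻¹ * x * g⁻¹⁻¹ = _
    rw [inv_inv]
  obtain ⟨χ, ⟨-, -, k, hk, hχ⟩, hχφ⟩ := hI.conj_mem S S le_rfl hS φ ⟨hS, hS, g, hg, hφ⟩
    ((Subgroup.inclusion hTc).comp e.toMonoidHom)
    (IsoOn.hom_mem hF ⟨e, he, hef⟩ le_rfl _ hef)
  refine ⟨k, hk, fun r hr => ?_⟩
  have h1 := (hχφ ⟨r, hr⟩).symm.trans (hχ _)
  rw [← hef ⟨r, hr⟩, ← hφ ⟨r, hr⟩, ← hef]
  exact h1

/-! ### The `p`-group `cosetAut` -/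

/-- The `F`-automorphisms of `T` that induce the conjugation by an element of `Q` on `T ∩ Q` and
the identity on the cosets of `T ∩ Q`. -/
def cosetAut (hF : F.IsFusionSystem) {T : Subgroup G} (hT : T ≤ F.carrier) (Q : Subgroup G) :
    Subgroup (MulAut T) where
  carrier := {α | α ∈ hF.aut T hT ∧ (∃ h ∈ Q, ∀ x : T, (x : G) ∈ Q → (α x : G) = h⁻¹ * x * h) ∧
    ∀ x : T, (x : G)⁻¹ * α x ∈ Q}
  one_mem' := ⟨one_mem _, ⟨1, one_mem _, by simp⟩, by simp⟩
  mul_mem' := by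
    rintro α β ⟨hα, ⟨h, hh, hαh⟩, hαQ⟩ ⟨hβ, ⟨k, hk, hβk⟩, hβQ⟩
    refine ⟨mul_mem hα hβ, ⟨k * h, mul_mem hk hh, fun x hx => ?_⟩, fun x => ?_⟩
    · rw [MulAut.mul_apply, hαh, hβk x hx]
      · group
      · rw [hβk x hx]; exact mul_mem (mul_mem (inv_mem hk) hx) hk
    · simpa [mul_assoc] using mul_mem (hβQ x) (hαQ (β x))
  inv_mem' := by
    rintro α ⟨hα, ⟨h, hh, hαh⟩, hαQ⟩
    have key : ∀ x : T, ((α⁻¹ x : T) : G)⁻¹ * x ∈ Q := fun x => by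
      simpa using hαQ (α⁻¹ x)
    refine ⟨inv_mem hα, ⟨h⁻¹, inv_mem hh, fun x hx => ?_⟩, fun x => ?_⟩
    · have hy : ((α⁻¹ x : T) : G) ∈ Q := by
        have := mul_mem hx (inv_mem (key x))
        simpa using this
      have := hαh _ hy
      rw [MulAut.apply_inv_self] at this
      rw [this]; group
    · simpa using inv_mem (key x)

/-- The exponent divides `|G|²`: the power `β = α ^ |G|` fixes `T ∩ Q` pointwise, hence fixes `x⁻¹ *
β x`, so `β ^ m` sends `x` to `x * (x⁻¹ * β x) ^ m`. -/
theorem cosetAut_isPGroup [Finite G] [Fact p.Prime] (hP : IsPGroup p G) (hF : F.IsFusionSystem)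
    {T : Subgroup G} (hT : T ≤ F.carrier) : IsPGroup p (cosetAut hF hT Q) := by
  obtain ⟨n, hn⟩ := IsPGroup.iff_card.1 hP
  rintro ⟨α, hα⟩
  refine ⟨n + n, Subtype.ext ?_⟩
  change α ^ p ^ (n + n) = 1
  rw [pow_add, pow_mul, ← hn]
  obtain ⟨-, ⟨h, hh, hαh⟩, -⟩ := id hα
  have h1 : ∀ (m : ℕ) (x : T), (x : G) ∈ Q → ((α ^ m) x : G) = (h ^ m)⁻¹ * x * h ^ m := by
    intro m
    induction m with
    | zero => simp
    | succ k ih =>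
      intro x hx
      have hx' : (α x : G) ∈ Q := by
        rw [hαh x hx]; exact mul_mem (mul_mem (inv_mem hh) hx) hh
      rw [pow_succ, MulAut.mul_apply, ih _ hx', hαh x hx, pow_succ']
      group
  obtain ⟨β, hβ⟩ : ∃ β, β = α ^ Nat.card G := ⟨_, rfl⟩
  rw [← hβ]
  have hβ1 : ∀ x : T, (x : G) ∈ Q → β x = x := fun x hx => by
    ext; rw [hβ, h1 _ x hx, pow_card_eq_one']; simp
  have hβQ : ∀ x : T, (x : G)⁻¹ * β x ∈ Q :=
    hβ ▸ (pow_mem hα (Nat.card G)).2.2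
  have h2 : ∀ (m : ℕ) (x : T), (β ^ m) x = x * (x⁻¹ * β x) ^ m := by
    intro m
    induction m with
    | zero => simp
    | succ k ih =>
      intro x
      rw [pow_succ', MulAut.mul_apply, ih, map_mul, map_pow, hβ1 (x⁻¹ * β x) (hβQ x), pow_succ',
        ← mul_assoc, mul_inv_cancel_left]
  ext x
  rw [h2, Subgroup.coe_mul, Subgroup.coe_pow, pow_card_eq_one']
  simp

/-- Invariance transports the action on `R ∩ Q`, and strong closure transports the triviality on
cosets. -/
theorem congr_mem_cosetAut [Finite G] (hF : F.IsFusionSystem)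
    (hI : IsInvariant (inner Q) F) {R T : Subgroup G} (hR : R ≤ F.carrier) (hT : T ≤ F.carrier)
    {e : R ≃* T} (he : e.toMonoidHom ∈ F.Hom R T) {α : MulAut R} (hα : α ∈ cosetAut hF hR Q) :
    MulAut.congr e α ∈ cosetAut hF hT Q := by
  obtain ⟨hαF, ⟨h, hh, hαh⟩, hαQ⟩ := hα
  have hQ : F.StronglyClosed Q := hI.stronglyClosed
  have hi : F.IsoOn R (extendFun e.toMonoidHom) T :=
    ⟨e, he, fun x => (extendFun_apply e.toMonoidHom x).symm⟩
  set f := extendFun e.toMonoidHom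
  have hfe : ∀ x : R, f x = e x := fun x => extendFun_apply e.toMonoidHom x
  have hcongr : ∀ x : T, MulAut.congr e α x = e (α (e.symm x)) := fun x => rfl
  refine ⟨hF.comp_mem (hF.comp_mem (hF.symm_mem e he) hαF) he, ?_, fun x => ?_⟩
  · obtain ⟨U, -, hU⟩ := hi.restrict hF (inf_le_left : R ⊓ Q ≤ R)
    -- Conjugation by `h` agrees with `α` on `R ∩ Q`, so it keeps this group inside `R`, and inside
    -- `Q` because `h ∈ Q`.
    have hhn : h ∈ Subgroup.normalizer ((R ⊓ Q : Subgroup G) : Set G) := by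
      rw [← Subgroup.inv_mem_iff]
      refine Subgroup.mem_normalizer_fintype fun x hx => ?_
      rw [inv_inv]
      refine Subgroup.mem_inf.2 ⟨?_, mul_mem (mul_mem (inv_mem hh) hx.2) hh⟩
      rw [← hαh ⟨x, hx.1⟩ hx.2]
      exact SetLike.coe_mem _
    obtain ⟨k, hk, hfk⟩ := hI.exists_conj hF hU inf_le_right hh hhn
    refine ⟨k, hk, fun x hx => ?_⟩
    have hi' : F.IsoOn T (extendFun e.symm.toMonoidHom) R :=
      ⟨e.symm, hF.symm_mem e he, fun x => (extendFun_apply e.symm.toMonoidHom x).symm⟩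
    have hy : (e.symm x : G) ∈ Q := by
      have := hQ.map_mem hF hi' x.2 hx
      rwa [extendFun_apply] at this
    rw [hcongr, ← hfe, hαh _ hy, hfk _ ⟨SetLike.coe_mem _, hy⟩, hfe]
    simp
  · have := hQ.map_mem hF hi (SetLike.coe_mem ((e.symm x)⁻¹ * α (e.symm x))) (hαQ _)
    rw [hfe] at this
    simpa [hcongr] using this

/-- `Aut_P(T)` normalizes the `p`-group `cosetAut`, so the two generate a `p`-group, which cannot
exceed the maximal `p`-subgroup `Aut_P(T)`. -/
theorem cosetAut_le_conjAut [Finite G] [Fact p.Prime] (hP : IsPGroup p G) (hc : F.carrier = ⊤)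
    (hF : F.IsSaturated p) (hI : IsInvariant (inner Q) F) {T : Subgroup G}
    (hT : F.FullyNormalized T) :
    cosetAut hF.toIsFusionSystem hT.1 Q ≤ conjAut F.carrier T := by
  have hle := hF.conjAut_le_aut hT.1
  have hn : conjAut F.carrier T ≤
      Subgroup.normalizer (cosetAut hF.toIsFusionSystem hT.1 Q : Set (MulAut T)) := by
    have key : ∀ c ∈ conjAut F.carrier T, ∀ α ∈ cosetAut hF.toIsFusionSystem hT.1 Q,
        c * α * c⁻¹ ∈ cosetAut hF.toIsFusionSystem hT.1 Q := fun c hc' α hα =>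
      congr_mem_cosetAut hF.toIsFusionSystem hI hT.1 hT.1 (hle hc') hα
    refine fun c hc' => Subgroup.mem_normalizer_iff.2 fun α => ⟨key c hc' α, fun h => ?_⟩
    have := key c⁻¹ (inv_mem hc') _ h
    simpa [mul_assoc] using this
  refine le_sup_right.trans (hF.fullyAutomized hP hc hT (conjAut F.carrier T ⊔ _)
    ((conjAut_isPGroup hP _ _).to_sup_of_normal_right' (cosetAut_isPGroup hP _ hT.1) hn) ?_
    le_sup_left)
  exact sup_le hle fun α hα => hα.1

/-! ### Extending `F`-isomorphisms from `R` to `RQ` -/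

/-- An `F`-isomorphism `f : R → T` onto a fully normalized subgroup extends to `R N_Q(R)`. -/
theorem IsInvariant.exists_extension_inf_normalizer [Finite G] [Fact p.Prime] (hP : IsPGroup p G)
    (hc : F.carrier = ⊤) (hF : F.IsSaturated p) (hI : IsInvariant (inner Q) F)
    {R T : Subgroup G} {f : G → G} (h : F.IsoOn R f T) (hT : F.FullyNormalized T) :
    ∃ g U, F.IsoOn ((R ⊔ Q) ⊓ Subgroup.normalizer (R : Set G)) g U ∧ ∀ x ∈ R, g x = f x := by
  have hn : Q.Normal := StronglyClosed.normal hc hF.toIsFusionSystem hI.stronglyClosed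
  have hQc : ∀ g, g ∈ F.carrier := fun g => hc ▸ Subgroup.mem_top g
  obtain ⟨e, he, hef⟩ := id h
  obtain ⟨g, U, hg, hgf⟩ := hF.exists_extension hc
    (N := (R ⊔ Q) ⊓ Subgroup.normalizer (R : Set G)) h hT fun x hx => by
    refine ⟨hx.2, ?_⟩
    obtain ⟨r, hr, q, hq, rfl⟩ := Subgroup.mem_sup_of_normal_right.1 hx.1
    have hrn := le_norm_self R hr
    have hqn : q ∈ Subgroup.normalizer (R : Set G) := by
      simpa using mul_mem (inv_mem hrn) hx.2
    let α : MulAut R := R.normalizerMonoidHom ⟨q⁻¹, inv_mem hqn⟩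
    have hα : ∀ x : R, (α x : G) = q⁻¹ * x * q := fun x => by
      change q⁻¹ * x * q⁻¹⁻¹ = _
      rw [inv_inv]
    have hαQ : α ∈ cosetAut hF.toIsFusionSystem h.source_le Q := by
      refine ⟨hF.conj_mem h.source_le h.source_le q (hQc q) _ hα, ⟨q, hq, fun x _ => hα x⟩,
        fun x => ?_⟩
      rw [hα, ← mul_assoc, ← mul_assoc]
      refine mul_mem ?_ hq
      simpa using hn.conj_mem _ (inv_mem hq) (x : G)⁻¹
    have hβ := cosetAut_le_conjAut hP hc hF hI hT
      (congr_mem_cosetAut hF.toIsFusionSystem hI h.source_le hT.1 he hαQ)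
    rw [hc] at hβ
    obtain ⟨z, hz, hzβ⟩ := mem_conjAut_top.1 hβ
    -- For `x = r * q`, conjugation by `r` is carried by `f` to conjugation by `f r`, and
    -- conjugation by `q` to `t ↦ z * t * z⁻¹`.
    refine ⟨f r * z⁻¹, mul_mem (le_norm_self T (h.mem hr)) (inv_mem hz), fun y hy => ?_⟩
    have hy' : r⁻¹ * y * r ∈ R := mul_mem (mul_mem (inv_mem hr) hy) hr
    have := hzβ (e ⟨_, hy'⟩)
    rw [show MulAut.congr e α (e ⟨_, hy'⟩) = e (α ⟨_, hy'⟩) by simp [MulAut.congr], hef, hef, hα,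
      h.map_conj hr hy] at this
    rw [show (r * q)⁻¹ * y * (r * q) = q⁻¹ * (r⁻¹ * y * r) * q by group, this]
    group
  exact ⟨g, U, hg, fun x hx => hgf x ⟨hx, Subgroup.mem_sup_left hx, le_norm_self R hx⟩⟩

theorem lt_inf_normalizer [Finite G] [Fact p.Prime] (hP : IsPGroup p G) {R K : Subgroup G}
    (h : R < K) : R < K ⊓ Subgroup.normalizer (R : Set G) := by
  refine lt_of_le_of_ne (le_inf h.le (le_norm_self R)) fun heq => ?_
  have hne : R.subgroupOf K ≠ ⊤ := by
    rw [Ne, Subgroup.subgroupOf_eq_top]; exact h.not_ge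
  obtain ⟨x, hx, hxR⟩ := SetLike.exists_of_lt (lt_normalizer_of_ne_top (hP.to_subgroup K) hne)
  refine hxR (heq.ge ⟨x.2, Subgroup.mem_normalizer_fintype fun r hr => ?_⟩)
  exact (Subgroup.mem_normalizer_iff.1 hx ⟨r, h.le hr⟩).1 hr

theorem StronglyClosed.isoOn_self [Finite G] (hF : F.IsFusionSystem) (hQ : F.StronglyClosed Q)
    {R T : Subgroup G} {f : G → G} (h : F.IsoOn R f T) (hQR : Q ≤ R) : F.IsoOn Q f Q := by
  obtain ⟨U, -, hU⟩ := h.restrict hF hQR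
  have hUQ : U ≤ Q := fun y hy => by
    obtain ⟨x, hx, rfl⟩ := hU.exists_eq hy
    exact hQ.map_mem hF hU hx hx
  have := Subgroup.eq_of_le_of_card_ge hUQ hU.card_eq.le
  rwa [this] at hU

/-- The extension maps `Q` onto itself, so its image is the product of `T` and `Q`. -/
theorem StronglyClosed.target_eq [Finite G] (hc : F.carrier = ⊤) (hF : F.IsFusionSystem)
    (hQ : F.StronglyClosed Q) {R T U : Subgroup G} {f : G → G} (h : F.IsoOn (R ⊔ Q) f U)
    (hR : F.IsoOn R f T) : U = T ⊔ Q := by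
  have hn := hQ.normal hc hF
  have hQQ := hQ.isoOn_self hF h le_sup_right
  refine le_antisymm (fun y hy => ?_) (sup_le (fun y hy => ?_) fun y hy => ?_)
  · obtain ⟨x, hx, rfl⟩ := h.exists_eq hy
    obtain ⟨r, hr, q, hq, rfl⟩ := Subgroup.mem_sup_of_normal_right.1 hx
    rw [h.map_mul (Subgroup.mem_sup_left hr) (Subgroup.mem_sup_right hq)]
    exact Subgroup.mul_mem_sup (hR.mem hr) (hQQ.mem hq)
  · obtain ⟨x, hx, rfl⟩ := hR.exists_eq hy
    exact h.mem (Subgroup.mem_sup_left hx)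
  · obtain ⟨x, hx, rfl⟩ := hQQ.exists_eq hy
    exact h.mem (Subgroup.mem_sup_right hx)

/-- If `F_Q(Q)` is `F`-invariant, every `F`-isomorphism with domain `R` extends to `RQ`. -/
theorem IsInvariant.exists_extension_sup [Finite G] [Fact p.Prime] (hP : IsPGroup p G)
    (hc : F.carrier = ⊤) (hF : F.IsSaturated p) (hI : IsInvariant (inner Q) F)
    {R T : Subgroup G} {f : G → G} (h : F.IsoOn R f T) :
    ∃ g, F.IsoOn (R ⊔ Q) g (T ⊔ Q) ∧ ∀ x ∈ R, g x = f x := by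
  have hQ : F.StronglyClosed Q := hI.stronglyClosed
  have hFF := hF.toIsFusionSystem
  induction hn : Nat.card G - Nat.card R using Nat.strong_induction_on generalizing R T f with
  | _ n ih =>
  -- Stated for every domain of order `|R|`, because it is needed both for `R` and for `T`.
  have key : ∀ {R' T' : Subgroup G} {f' : G → G}, Nat.card R' = Nat.card R →
      F.IsoOn R' f' T' → F.FullyNormalized T' →
      ∃ g, F.IsoOn (R' ⊔ Q) g (T' ⊔ Q) ∧ ∀ x ∈ R', g x = f' x := by
    intro R' T' f' hcard h' hT'
    suffices ∃ g U, F.IsoOn (R' ⊔ Q) g U ∧ ∀ x ∈ R', g x = f' x by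
      obtain ⟨g, U, hg, hgf⟩ := this
      rw [hQ.target_eq hc hFF hg (h'.congr fun x hx => (hgf x hx).symm)] at hg
      exact ⟨g, hg, hgf⟩
    by_cases hQR : Q ≤ R'
    · exact ⟨f', T', by rwa [sup_eq_left.2 hQR], fun _ _ => rfl⟩
    have hlt := lt_inf_normalizer hP (left_lt_sup.2 hQR)
    obtain ⟨g, U, hg, hgf⟩ := hI.exists_extension_inf_normalizer hP hc hF h' hT'
    set N := (R' ⊔ Q) ⊓ Subgroup.normalizer (R' : Set G)
    have hcN : Nat.card R' < Nat.card N :=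
      lt_of_le_of_ne (Subgroup.card_le_of_le hlt.le) fun h =>
        hlt.ne (Subgroup.eq_of_le_of_card_ge hlt.le h.ge)
    have hNG : Nat.card N ≤ Nat.card G := Subgroup.card_le_card_group N
    obtain ⟨g', hg', hgg⟩ := ih _ (by omega) hg rfl
    -- The extension obtained by induction on the larger subgroup `N` already has the desired
    -- domain.
    have : N ⊔ Q = R' ⊔ Q :=
      le_antisymm (sup_le inf_le_left le_sup_right) (sup_le_sup_right hlt.le Q)
    rw [this] at hg'
    exact ⟨g', _, hg', fun x hx => (hgg x (hlt.le hx)).trans (hgf x hx)⟩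
  obtain ⟨τ, M, hτ, hM⟩ := hFF.exists_fullyNormalized h.target_le
  obtain ⟨g₁, hg₁, hgf₁⟩ := key rfl (h.trans hFF hτ) hM
  obtain ⟨g₂, hg₂, hgf₂⟩ := key h.card_eq.symm hτ hM
  -- With `g₁` extending `f` followed by `τ`, and `g₂` extending `τ`, the map `g₁` followed by
  -- `g₂⁻¹` extends `f`.
  obtain ⟨g₃, hg₃, hg₃₂, -⟩ := hg₂.symm hFF
  refine ⟨_, hg₁.trans hFF hg₃, fun x hx => ?_⟩
  rw [hgf₁ x hx, ← hgf₂ _ (h.mem hx), hg₃₂ _ (Subgroup.mem_sup_left (h.mem hx))]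

/-! ### Saturation of `F_Q(Q)` -/

/-- The conjugation `x ↦ x ^ g` by an element `g` of `Q`, from a subgroup of `Q` to `Q`. -/
def conjHom {R Q : Subgroup G} (hR : R ≤ Q) (g : Q) : R →* Q :=
  (MulAut.conj g⁻¹).toMonoidHom.comp (Subgroup.inclusion hR)

theorem conjHom_apply {R Q : Subgroup G} (hR : R ≤ Q) (g : Q) (x : R) :
    (conjHom hR g x : G) = (g : G)⁻¹ * x * g := by
  change (g : G)⁻¹ * x * (g : G)⁻¹⁻¹ = _
  rw [inv_inv]

theorem inner_isFusionSystem (Q : Subgroup G) : (inner Q).IsFusionSystem where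
  comp_mem := by
    rintro R S T φ ψ ⟨hR, -, g, hg, hφ⟩ ⟨-, hT, h, hh, hψ⟩
    exact ⟨hR, hT, g * h, mul_mem hg hh, fun x => by
      rw [MonoidHom.comp_apply, hψ, hφ]; group⟩
  conj_mem := fun hR hS g hg _ hφ => ⟨hR, hS, g, hg, hφ⟩
  toImage_mem := by
    rintro R S φ ⟨hR, hS, g, hg, hφ⟩
    refine ⟨hR, ?_, g, hg, hφ⟩
    rintro _ ⟨x, rfl⟩
    exact hS (SetLike.coe_mem _)
  symm_mem := by
    rintro R S e ⟨hR, hS, g, hg, he⟩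
    refine ⟨hS, hR, g⁻¹, inv_mem hg, fun x => ?_⟩
    have := he (e.symm x)
    rw [MulEquiv.toMonoidHom_eq_coe, MonoidHom.coe_coe, MulEquiv.apply_symm_apply] at this
    rw [MulEquiv.toMonoidHom_eq_coe, MonoidHom.coe_coe, this]
    group

theorem inner_aut (Q : Subgroup G) :
    (inner_isFusionSystem Q).aut Q le_rfl = conjAut Q Q := by
  refine le_antisymm ?_ ((inner_isFusionSystem Q).conjAut_le_aut le_rfl)
  rintro α ⟨-, -, g, hg, hα⟩
  refine ⟨⟨g⁻¹, inv_mem (le_norm_self Q hg)⟩, inv_mem hg, ?_⟩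
  ext x
  refine Eq.trans ?_ (hα x).symm
  change g⁻¹ * x * g⁻¹⁻¹ = _
  rw [inv_inv]

/-- The fusion system of a `p`-group is saturated. -/
theorem inner_isSaturated (hP : IsPGroup p G) (Q : Subgroup G) : (inner Q).IsSaturated p where
  toIsFusionSystem := inner_isFusionSystem Q
  sylow := by
    let S : Sylow p ((inner_isFusionSystem Q).aut Q le_rfl) :=
      { toSubgroup := ⊤
        isPGroup' := IsPGroup.of_equiv
          (inner_aut Q ▸ conjAut_isPGroup hP Q Q) Subgroup.topEquiv.symm
        is_maximal' := fun _ h => top_le_iff.1 h }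
    refine ⟨S, ?_⟩
    change (⊤ : Subgroup ((inner_isFusionSystem Q).aut Q le_rfl)).map _ = conjAut Q Q
    exact (MonoidHom.range_eq_map _).symm.trans ((Subgroup.range_subtype _).trans (inner_aut Q))
  extension := by
    rintro R φ ⟨hR, -, g, hg, hφ⟩ -
    change ∃ ψ ∈ (inner Q).Hom (extensionGroup Q φ) Q, _
    have hN : extensionGroup Q φ ≤ Q := fun x hx => hx.1.1
    have hRN : R ≤ extensionGroup Q φ := fun x hx => by
      refine ⟨⟨hR hx, le_norm_self R hx⟩, φ ⟨x, hx⟩, ⟨SetLike.coe_mem _,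
        le_norm_self _ ⟨⟨x, hx⟩, rfl⟩⟩, fun y z hz => ?_⟩
      -- An element `x` of `R` lies in `N_φ` with witness `xφ`, because `φ` is a homomorphism.
      rw [show z = ⟨x, hx⟩⁻¹ * y * ⟨x, hx⟩ from Subtype.ext hz, map_mul, map_mul, map_inv]
      rfl
    -- Conjugation by the element `g` inducing `φ` is defined on all of `N_φ`, since `N_φ ≤ Q`.
    refine ⟨conjHom hN ⟨g, hg⟩, ⟨hN, le_rfl, g, hg, conjHom_apply hN ⟨g, hg⟩⟩, hRN, fun x => ?_⟩
    rw [hφ]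
    exact conjHom_apply hN ⟨g, hg⟩ _

/-! ### The two implications -/

theorem eq_normalizer_of_isInvariant [Finite G] [Fact p.Prime] (hP : IsPGroup p G)
    (hc : F.carrier = ⊤) (hF : F.IsSaturated p) (hI : IsInvariant (inner Q) F) :
    F = F.normalizer Q := by
  have hQ : F.StronglyClosed Q := hI.stronglyClosed
  have hn := hQ.normal hc hF.toIsFusionSystem
  have hnorm : norm F.carrier Q = ⊤ := by
    rw [hc, norm_top, Subgroup.normalizer_eq_top]
  refine PrefusionSystem.ext (hc.trans hnorm.symm) ?_
  ext R S φ
  refine ⟨fun hφ => ?_, fun h => h.2.2.1⟩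
  refine ⟨hnorm ▸ le_top, hnorm ▸ le_top, hφ, ?_⟩
  obtain ⟨g, hg, hgf⟩ := hI.exists_extension_sup hP hc hF
    (hF.isoOn_of_hom hφ fun x => (extendFun_apply φ x).symm)
  have him : image φ ≤ S := by
    rintro _ ⟨x, rfl⟩; exact SetLike.coe_mem _
  rw [sup_comm R, sup_comm _ Q] at hg
  -- The automorphism of `Q` required by `N_F(Q)` comes from strong closure: an injection of the
  -- finite group `Q` into itself is onto.
  obtain ⟨α, -, hα⟩ := hQ.isoOn_self hF.toIsFusionSystem hg le_sup_left
  obtain ⟨e, -, he⟩ := id hg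
  have hψ : ∀ x, (((Subgroup.inclusion (sup_le_sup_left him Q)).comp e.toMonoidHom x :
    (Q ⊔ S : Subgroup G)) : G) = g x := he
  refine ⟨_, hg.hom_mem hF.toIsFusionSystem (hc ▸ le_top) _ hψ, ⟨le_sup_right, fun x => ?_⟩,
    α, le_sup_left, fun x => ?_⟩
  · rw [hψ, ← extendFun_apply φ, ← hgf x x.2]; rfl
  · rw [hψ]; exact (hα x).symm

theorem isInvariant_of_eq_normalizer (hc : F.carrier = ⊤) (hF : F.IsFusionSystem)
    (h : F = F.normalizer Q) : IsInvariant (inner Q) F := by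
  have key : ∀ {R S : Subgroup G} {φ : R →* S}, φ ∈ F.Hom R S →
      ∃ ψ ∈ F.Hom (Q ⊔ R) (Q ⊔ S), Extends ψ φ ∧ ∃ α : MulAut Q, Extends ψ α.toMonoidHom := by
    intro R S φ hφ
    rw [h] at hφ
    exact hφ.2.2.2
  have hQc : Q ≤ F.carrier := hc ▸ le_top
  refine ⟨⟨inner_isFusionSystem Q, hQc, ?_⟩, ⟨hQc, ?_⟩, ?_⟩
  · rintro R S φ ⟨hR, hS, g, hg, hφ⟩
    exact hF.conj_mem (hR.trans hQc) (hS.trans hQc) g (hQc hg) φ hφ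
  · rintro R S hR φ hφ _ ⟨x, rfl⟩
    obtain ⟨ψ, -, ⟨hRQ, hψφ⟩, α, hQ, hψα⟩ := key hφ
    change (φ x : G) ∈ Q
    rw [← hψφ]
    exact (hψα ⟨x, hR x.2⟩).symm ▸ SetLike.coe_mem _
  · rintro R S hRS hS φ ⟨-, -, g, hg, hφ⟩ ψ₀ hψ₀
    obtain ⟨ψ, -, ⟨hSQ, hψφ⟩, α, hQ, hψα⟩ := key hψ₀
    have hα : ∀ x (hx : x ∈ S), (ψ₀ ⟨x, hx⟩ : G) = α ⟨x, hS hx⟩ := fun x hx =>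
      (hψφ ⟨x, hx⟩).symm.trans (hψα ⟨x, hS hx⟩)
    have him : image (ψ₀.comp (Subgroup.inclusion hRS)) ≤ Q := by
      rintro _ ⟨x, rfl⟩
      change (ψ₀ ⟨x, hRS x.2⟩ : G) ∈ Q
      rw [hα]; exact SetLike.coe_mem _
    -- `g` need not lie in the domain of `ψ₀`, but the automorphism `α` of `Q` agrees with `ψ₀` on
    -- `S` and is defined at `g`.
    let k : Q := α ⟨g, hg⟩
    refine ⟨conjHom him k, ⟨him, le_rfl, k, k.2, conjHom_apply him k⟩, fun r => ?_⟩
    have h1 : α ⟨φ r, hS (φ r).2⟩ = k⁻¹ * α ⟨r, hS (hRS r.2)⟩ * k := by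
      rw [← map_inv, ← map_mul, ← map_mul]
      exact congrArg α (Subtype.ext (hφ r))
    rw [hα _ (φ r).2, h1, Subgroup.coe_mul, Subgroup.coe_mul, Subgroup.coe_inv,
      ← hα r (hRS r.2)]
    exact conjHom_apply him k _

end PrefusionSystem

/-- A saturated fusion system `F` on a finite `p`-group `P` is equal to `N_F(Q)` if and only if
`F_Q(Q)` is a normal subsystem of `F`. -/
theorem theoremA (p : ℕ) [Fact p.Prime] {P : Type*} [Group P] [Finite P] (hP : IsPGroup p P)
    (F : PrefusionSystem P) (hFP : F.carrier = ⊤) (hF : F.IsSaturated p) (Q : Subgroup P) :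
    F = F.normalizer Q ↔ PrefusionSystem.IsNormalSubsystem p (PrefusionSystem.inner Q) F :=
  ⟨fun h => ⟨PrefusionSystem.isInvariant_of_eq_normalizer hFP hF.toIsFusionSystem h,
    PrefusionSystem.inner_isSaturated hP Q⟩,
  fun h => PrefusionSystem.eq_normalizer_of_isInvariant hP hFP hF h.1⟩
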